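/- Let $G$ be a finite simple graph on $n$ vertices with $(0,1)$-adjacency matrix $A$, let $e$ be the all-one vector of length $n$, and let $W=[e, Ae, A^2e,\dots,A^{n-1}e]$ be the walk matrix of $G$. Suppose that $\det W \neq 0$ and that $\det(W)/2^{\lfloor n/2\rfloor}$ is an odd square-free integer (that is, an odd integer, possibly negative, not divisible by the square of any prime; $\pm1$ is allowed). Then $G$ is determined by its generalized spectrum: if $H$ is any finite simple graph such that the adjacency matrices of $G$ and $H$ have the same eigenvalues with multiplicities, and the adjacency matrices of the complements of $G$ and $H$ have the same eigenvalues with multiplicities, then $H$ is isomorphic to $G$. -/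

import Mathlib

universe u v

namespace SimpleGraph

/-- The walk matrix `[e, A e, A² e, …, A^(n-1) e]` of a graph on `n` vertices, where `A` is the
adjacency matrix and `e` is the all-one vector. The column with index `j` is `A ^ j e`. -/
def walkMatrix {n : ℕ} (G : SimpleGraph (Fin n)) [DecidableRel G.Adj] :
    Matrix (Fin n) (Fin n) ℤ :=
  Matrix.of fun i j => Matrix.mulVec (G.adjMatrix ℤ ^ (j : ℕ)) (fun _ => 1) i

/-- The spectrum of a finite graph: the multiset of the eigenvalues of its adjacency matrix,
with multiplicities. -/
noncomputable def adjSpectrum {V : Type*} [Fintype V] [DecidableEq V]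
    (G : SimpleGraph V) [DecidableRel G.Adj] : Multiset ℝ :=
  (G.adjMatrix ℝ).charpoly.roots

/-- Two finite graphs have the same generalized spectrum: they are cospectral, and so are their
complements. -/
def SameGeneralizedSpectrum {V W : Type*} [Fintype V] [DecidableEq V] [Fintype W] [DecidableEq W]
    (G : SimpleGraph V) [DecidableRel G.Adj] (H : SimpleGraph W) [DecidableRel H.Adj] : Prop :=
  G.adjSpectrum = H.adjSpectrum ∧ Gᶜ.adjSpectrum = Hᶜ.adjSpectrum

/-- A finite graph is determined by its generalized spectrum if every finite graph (on any vertex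
set, in any universe `v`) with the same generalized spectrum is isomorphic to it. -/
def IsDGS {V : Type u} [Fintype V] [DecidableEq V] (G : SimpleGraph V) [DecidableRel G.Adj] :
    Prop :=
  ∀ (W : Type v) [Fintype W] [DecidableEq W] (H : SimpleGraph W) [DecidableRel H.Adj],
    SameGeneralizedSpectrum G H → Nonempty (H ≃g G)

end SimpleGraph

/-! Write W_A for `krylov A`. The characteristic polynomials of A and J - I - A determine all walk
counts e·A^k e (`sum_walk_eq_of_charpoly_eq`). Hence if B comes from a graph with the same
generalized spectrum, W_Aᵀ W_A = W_Bᵀ W_B, and Q = W_B W_A⁻¹ is a rational orthogonal matrix with QA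
= BQ and Qe = e. An integral such Q is a permutation matrix, so everything reduces to showing that
the least denominator l of Q is 1.

If a prime p divides l, some row u of lQ is nonzero mod p, and u·f(A)e ≡ 0 mod p, u·f(A)u ≡ 0 mod p²
for every integer polynomial f (`exists_isotropic_of_dvd`). Such a u puts too many factors p into
det W_A. If W_A has corank r mod p, then p^r divides the determinant, and one further factor appears
once a nonzero left kernel vector mod p lifts to one mod p² (`pow_walkCorank_succ_dvd_det`).

For odd p this gives p² ∣ det W_A (`sq_dvd_det_krylov`): if r = 1, isotropy puts u in the column
space of W_A, and u itself lifts. For p = 2 the adjacency matrix is alternating mod 2, which gives r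
≥ n/2 and, in case of equality, again puts the left kernel inside the column space; a vector built
from u then lifts, so 2^(n/2+1) ∣ det W_A (`two_pow_dvd_det_krylov`). Both contradict det W_A = k ·
2^(n/2) with k odd and square-free. -/

open Polynomial

namespace Matrix

/-! ### Walk vectors f(A)e as a module over polynomials. -/

section WalkMap

variable {n : ℕ} {R S : Type*} [CommRing R] [CommRing S]

/-- The walk matrix `[e, A e, …, A ^ (n - 1) e]` of a square matrix. -/
def krylov (A : Matrix (Fin n) (Fin n) R) : Matrix (Fin n) (Fin n) R :=
  Matrix.of fun i j => ((A ^ (j : ℕ)) *ᵥ (fun _ => 1)) i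

/-- The linear map `f ↦ f(A) e`. -/
noncomputable def walkMap (A : Matrix (Fin n) (Fin n) R) : R[X] →ₗ[R] (Fin n → R) :=
  (LinearMap.applyₗ (fun _ => 1)).comp (Matrix.toLin'.toLinearMap.comp (aeval A).toLinearMap)

theorem walkMap_apply (A : Matrix (Fin n) (Fin n) R) (f : R[X]) :
    walkMap A f = aeval A f *ᵥ (fun _ => 1) := by
  simp [walkMap]

theorem walkMap_one (A : Matrix (Fin n) (Fin n) R) : walkMap A 1 = fun _ => 1 := by
  simp [walkMap_apply]

theorem walkMap_X_pow (A : Matrix (Fin n) (Fin n) R) (k : ℕ) :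
    walkMap A (X ^ k) = (A ^ k) *ᵥ (fun _ => 1) := by
  simp [walkMap_apply]

theorem walkMap_mul (A : Matrix (Fin n) (Fin n) R) (f g : R[X]) :
    walkMap A (f * g) = aeval A f *ᵥ walkMap A g := by
  simp [walkMap_apply]

theorem walkMap_modByMonic (A : Matrix (Fin n) (Fin n) R) (f : R[X]) :
    walkMap A (f %ₘ A.charpoly) = walkMap A f := by
  rw [walkMap_apply, walkMap_apply,
    aeval_modByMonic_eq_self_of_root (aeval_self_charpoly A)]

theorem krylov_mulVec (A : Matrix (Fin n) (Fin n) R) (z : Fin n → R) :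
    krylov A *ᵥ z = walkMap A (∑ j : Fin n, C (z j) * X ^ (j : ℕ)) := by
  ext i
  simp only [mulVec, dotProduct, krylov, of_apply, map_sum, Finset.sum_apply]
  refine Finset.sum_congr rfl fun j _ => ?_
  rw [← smul_eq_C_mul, map_smul, walkMap_X_pow]
  simp [mulVec, dotProduct, mul_comm]

theorem eq_sum_fin_of_degree_lt {f : R[X]} (hf : f.degree < n) :
    f = ∑ j : Fin n, C (f.coeff j) * X ^ (j : ℕ) := by
  rw [Fin.sum_univ_eq_sum_range (fun j => C (f.coeff j) * X ^ j)]
  by_cases h0 : f = 0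
  · simp [h0]
  · exact f.as_sum_range_C_mul_X_pow' ((natDegree_lt_iff_degree_lt h0).2 hf)

/-- By Cayley–Hamilton only the remainder of f modulo the characteristic polynomial matters, and it
has degree below n. -/
theorem walkMap_eq_krylov_mulVec (A : Matrix (Fin n) (Fin n) R) (f : R[X]) :
    walkMap A f = krylov A *ᵥ fun j => (f %ₘ A.charpoly).coeff j := by
  rcases subsingleton_or_nontrivial R with h | h
  · exact Subsingleton.elim _ _
  rw [krylov_mulVec, ← walkMap_modByMonic]
  congr 1
  apply eq_sum_fin_of_degree_lt
  have := degree_modByMonic_lt f A.charpoly_monic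
  rwa [charpoly_degree_eq_dim, Fintype.card_fin] at this

theorem range_walkMap (A : Matrix (Fin n) (Fin n) R) :
    LinearMap.range (walkMap A) = LinearMap.range (krylov A).mulVecLin := by
  apply le_antisymm
  · rintro _ ⟨f, rfl⟩
    exact ⟨_, (walkMap_eq_krylov_mulVec A f).symm⟩
  · rintro _ ⟨z, rfl⟩
    exact ⟨_, (krylov_mulVec A z).symm⟩

theorem IsSymm.aeval {A : Matrix (Fin n) (Fin n) R} (hA : A.IsSymm) (f : R[X]) :
    (Polynomial.aeval A f).IsSymm := by
  induction f using Polynomial.induction_on' with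
  | add p q hp hq => rw [map_add]; exact hp.add hq
  | monomial k a =>
    rw [aeval_monomial, ← Algebra.smul_def]
    exact (hA.pow k).smul a

theorem IsSymm.mulVec_dotProduct {A : Matrix (Fin n) (Fin n) R} (hA : A.IsSymm)
    (x y : Fin n → R) : (A *ᵥ x) ⬝ᵥ y = x ⬝ᵥ (A *ᵥ y) := by
  rw [dotProduct_mulVec, ← mulVec_transpose, hA.eq]

theorem IsSymm.walkMap_dotProduct {A : Matrix (Fin n) (Fin n) R} (hA : A.IsSymm) (f g : R[X]) :
    walkMap A f ⬝ᵥ walkMap A g = (fun _ => 1) ⬝ᵥ walkMap A (f * g) := by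
  rw [walkMap_mul, walkMap_apply A f, (hA.aeval f).mulVec_dotProduct]

theorem map_aeval_mulVec (φ : R →+* S) (A : Matrix (Fin n) (Fin n) R) (f : R[X])
    (x : Fin n → R) :
    φ ∘ (Polynomial.aeval A f *ᵥ x) =
      Polynomial.aeval (A.map φ) (f.map φ) *ᵥ (φ ∘ x) := by
  have h : Polynomial.aeval (A.map φ) (f.map φ) = (Polynomial.aeval A f).map φ := by
    induction f using Polynomial.induction_on' with
    | add p q hp hq =>
      rw [Polynomial.map_add, map_add, hp, hq, map_add, Matrix.map_add _ (map_add φ)]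
    | monomial k a =>
      rw [Polynomial.map_monomial, aeval_monomial, aeval_monomial, ← Algebra.smul_def,
        ← Algebra.smul_def, Matrix.map_smul' _ _ _ (map_mul φ)]
      congr 1
      exact (map_pow φ.mapMatrix A k).symm
  ext i
  rw [h, Function.comp_apply, RingHom.map_mulVec]

theorem walkMap_map (φ : R →+* S) (A : Matrix (Fin n) (Fin n) R) (f : R[X]) :
    walkMap (A.map φ) (f.map φ) = φ ∘ walkMap A f := by
  rw [walkMap_apply, walkMap_apply, map_aeval_mulVec]
  congr 1
  ext
  simp

theorem krylov_map (φ : R →+* S) (A : Matrix (Fin n) (Fin n) R) :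
    krylov (A.map φ) = (krylov A).map φ := by
  ext i j
  have := congrFun (walkMap_map φ A (X ^ (j : ℕ))) i
  rw [Polynomial.map_pow, Polynomial.map_X, walkMap_X_pow, Function.comp_apply,
    walkMap_X_pow] at this
  exact this

end WalkMap

/-! ### Powers of p dividing a determinant. -/

section DetDivisibility

variable {n : ℕ} {p : ℕ} [Fact p.Prime]

/-- The matrix P with columns β has determinant prime to p, and the columns of M P carry the factors
p ^ w k. -/
theorem pow_sum_dvd_det_of_basis {κ : Type*} [Fintype κ] (M : Matrix (Fin n) (Fin n) ℤ)
    (b : Module.Basis κ (ZMod p) (Fin n → ZMod p)) (β : κ → Fin n → ℤ)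
    (hβ : ∀ k, Int.castRingHom (ZMod p) ∘ β k = b k) (w : κ → ℕ)
    (h : ∀ k i, (p : ℤ) ^ w k ∣ (M *ᵥ β k) i) :
    (p : ℤ) ^ (∑ k, w k) ∣ M.det := by
  classical
  have hp : p.Prime := Fact.out
  obtain ⟨e⟩ : Nonempty (κ ≃ Fin n) := by
    refine ⟨Fintype.equivFinOfCardEq ?_⟩
    rw [← Module.finrank_eq_card_basis b]
    simp
  let P : Matrix (Fin n) (Fin n) ℤ := of fun i j => β (e.symm j) i
  have hP : P.map (Int.castRingHom (ZMod p)) =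
      (Pi.basisFun (ZMod p) (Fin n)).toMatrix (b.reindex e) := by
    ext i j
    simp [P, Module.Basis.toMatrix_apply, ← hβ]
  have hdet : ¬ (p : ℤ) ∣ P.det := by
    intro hdvd
    have h1 : (P.map (Int.castRingHom (ZMod p))).det = 0 := by
      have := (Int.castRingHom (ZMod p)).map_det P
      rw [RingHom.mapMatrix_apply] at this
      rw [← this]
      exact (ZMod.intCast_zmod_eq_zero_iff_dvd _ _).2 hdvd
    rw [hP] at h1
    let := (Pi.basisFun (ZMod p) (Fin n)).invertibleToMatrix (b.reindex e)
    exact (isUnit_det_of_invertible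
      ((Pi.basisFun (ZMod p) (Fin n)).toMatrix (b.reindex e))).ne_zero h1
  choose c hc using h
  have hMP : M * P = of fun i j => (p : ℤ) ^ w (e.symm j) * c (e.symm j) i := by
    ext i j
    exact hc (e.symm j) i
  have hprod : (p : ℤ) ^ (∑ k, w k) ∣ M.det * P.det := by
    rw [← det_mul, hMP]
    rw [show (of fun i j => (p : ℤ) ^ w (e.symm j) * c (e.symm j) i) = of fun i j =>
      (fun j => (p : ℤ) ^ w (e.symm j)) j * (of fun i j => c (e.symm j) i : Matrix _ _ ℤ) i j
      from rfl, det_mul_row,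
      Finset.prod_pow_eq_pow_sum, Equiv.sum_comp e.symm w]
    exact Dvd.intro _ rfl
  have hcop : IsCoprime ((p : ℤ) ^ (∑ k, w k)) P.det :=
    IsCoprime.pow_left ((Nat.prime_iff_prime_int.1 hp).coprime_iff_not_dvd.2 hdet)
  exact hcop.dvd_of_dvd_mul_right hprod

/-- If the reduction of `M` modulo `p` has a kernel of dimension `k`, and `M` sends a vector that is
nonzero modulo `p` to a multiple of `p ^ (c + 1)`, then `p ^ (k + c)` divides `det M`. -/
theorem pow_finrank_ker_add_dvd_det (M : Matrix (Fin n) (Fin n) ℤ) (c : ℕ) (v : Fin n → ℤ)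
    (hv : Int.castRingHom (ZMod p) ∘ v ≠ 0) (hMv : ∀ i, (p : ℤ) ^ (c + 1) ∣ (M *ᵥ v) i) :
    (p : ℤ) ^ (Module.finrank (ZMod p)
      (LinearMap.ker (M.map (Int.castRingHom (ZMod p))).mulVecLin) + c) ∣ M.det := by
  classical
  set φ := Int.castRingHom (ZMod p) with hφ
  set K := LinearMap.ker (M.map φ).mulVecLin with hK
  have hker : ∀ x : Fin n → ℤ, φ ∘ x ∈ K ↔ ∀ i, (p : ℤ) ∣ (M *ᵥ x) i := by
    intro x
    rw [hK, LinearMap.mem_ker, mulVecLin_apply, funext_iff]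
    refine forall_congr' fun i => ?_
    rw [← RingHom.map_mulVec]
    exact ZMod.intCast_zmod_eq_zero_iff_dvd _ _
  have hvK : φ ∘ v ∈ K := (hker v).2 fun i => (dvd_pow_self _ c.succ_ne_zero).trans (hMv i)
  -- Adapted basis: extend v mod p to a basis t of the kernel, then to a basis B of the whole space.
  -- Vectors of t get weight 1, and v gets c more.
  obtain ⟨t, htK, hst, hKt, hli⟩ := exists_linearIndepOn_id_extension
    (K := ZMod p) (s := {φ ∘ v}) (t := (K : Set (Fin n → ZMod p)))
    (LinearIndepOn.singleton (v := id) hv) (by simpa using hvK)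
  obtain ⟨B, -, htB, hBspan, hBli⟩ := exists_linearIndepOn_id_extension hli (Set.subset_univ t)
  have hspan : K = Submodule.span (ZMod p) t :=
    le_antisymm hKt (Submodule.span_le.2 htK)
  have hBfin : B.Finite := hBli.linearIndependent.setFinite
  have hfr : Module.finrank (ZMod p) K = t.ncard := by
    have := (hBfin.subset htB).fintype
    rw [hspan, finrank_span_set_eq_card hli, Set.ncard_eq_toFinset_card']
  have : Fintype B := hBfin.fintype
  let b : Module.Basis B (ZMod p) (Fin n → ZMod p) :=
    Module.Basis.mk (v := ((↑) : B → _)) hBli.linearIndependent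
      (by rw [Subtype.range_coe]; exact fun x _ => hBspan (Set.mem_univ x))
  have hsurj : ∀ y : Fin n → ZMod p, ∃ x : Fin n → ℤ, φ ∘ x = y := fun y =>
    ⟨fun i => (y i).cast, by ext i; simp [φ]⟩
  choose lift hlift using hsurj
  let β : B → Fin n → ℤ := fun x => if (x : Fin n → ZMod p) = φ ∘ v then v else lift x
  let w : B → ℕ := fun x => (if (x : Fin n → ZMod p) ∈ t then 1 else 0) +
    (if (x : Fin n → ZMod p) = φ ∘ v then c else 0)
  have hvt : φ ∘ v ∈ t := hst rfl
  have key := pow_sum_dvd_det_of_basis M b β (fun k => by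
    by_cases h : (k : Fin n → ZMod p) = φ ∘ v
    · simp only [β, b, if_pos h, Module.Basis.mk_apply, h]; rfl
    · simp [β, b, h, hlift, ← hφ]) w (fun k i => by
    by_cases h : (k : Fin n → ZMod p) = φ ∘ v
    · simpa [β, w, h, hvt, add_comm] using hMv i
    · by_cases h' : (k : Fin n → ZMod p) ∈ t
      · simpa [β, w, h, h'] using (hker (lift k)).1 (by rw [hlift]; exact htK h') i
      · simp [w, h, h'])
  convert key using 2
  simp only [w, Finset.sum_add_distrib]
  rw [hfr]
  congr 1
  · rw [Finset.sum_boole, Nat.cast_id, Set.ncard_eq_toFinset_card t (hBfin.subset htB)]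
    symm
    refine Finset.card_bij (fun x _ => (x : Fin n → ZMod p)) ?_ ?_ ?_
    · simp
    · intro a _ b _ h; exact Subtype.ext h
    · intro y hy
      have hy' : y ∈ t := by simpa using hy
      exact ⟨⟨y, htB hy'⟩, by simpa using hy', rfl⟩
  · rw [Finset.sum_eq_single ⟨φ ∘ v, htB hvt⟩]
    · simp
    · intro x _ hx
      rw [if_neg]
      exact fun h => hx (Subtype.ext h)
    · simp

/-- The row space is the annihilator of the kernel. -/
theorem mem_range_transpose_mulVecLin {F : Type*} [Field F] (M : Matrix (Fin n) (Fin n) F)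
    (y : Fin n → F) (h : ∀ z, M *ᵥ z = 0 → y ⬝ᵥ z = 0) :
    y ∈ LinearMap.range Mᵀ.mulVecLin := by
  have hy : dotProductEquiv F (Fin n) y ∈ (LinearMap.ker M.mulVecLin).dualAnnihilator := by
    rw [Submodule.mem_dualAnnihilator]
    exact fun z hz => h z hz
  rw [← LinearMap.range_dualMap_eq_dualAnnihilator_ker] at hy
  obtain ⟨g, hg⟩ := hy
  obtain ⟨x, rfl⟩ := (dotProductEquiv F (Fin n)).surjective g
  refine ⟨x, ?_⟩
  apply (dotProductEquiv F (Fin n)).injective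
  rw [← hg]
  ext z
  simp only [mulVec_transpose, mulVecLin_apply, LinearMap.dualMap_apply, dotProductEquiv_apply_apply,
    LinearMap.coe_comp, Function.comp_apply, dotProduct_mulVec]

/-- If pairing with `v` maps the integer vectors `W z` divisible by `p` to multiples of `p ^ 2`,
then `v` can be corrected modulo `p` to a vector `v'` with `Wᵀ v'` divisible by `p ^ 2`. -/
theorem exists_lift_transpose_mulVec (W : Matrix (Fin n) (Fin n) ℤ) (v : Fin n → ℤ)
    (h₁ : ∀ i, (p : ℤ) ∣ (Wᵀ *ᵥ v) i)
    (h₂ : ∀ z, (∀ i, (p : ℤ) ∣ (W *ᵥ z) i) → (p : ℤ) ^ 2 ∣ v ⬝ᵥ (W *ᵥ z)) :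
    ∃ v' : Fin n → ℤ, Int.castRingHom (ZMod p) ∘ v' = Int.castRingHom (ZMod p) ∘ v ∧
      ∀ i, (p : ℤ) ^ 2 ∣ (Wᵀ *ᵥ v') i := by
  have hp : p.Prime := Fact.out
  have hp0 : (p : ℤ) ≠ 0 := by exact_mod_cast hp.ne_zero
  choose y hy using h₁
  have hyv : Wᵀ *ᵥ v = (p : ℤ) • y := by ext i; simp [hy]
  set φ := Int.castRingHom (ZMod p) with hφ
  have hsurj : ∀ y : Fin n → ZMod p, ∃ x : Fin n → ℤ, φ ∘ x = y := fun y =>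
    ⟨fun i => (y i).cast, by ext i; simp [φ]⟩
  -- With Wᵀ v = p y, the vector v - p x works as soon as Wᵀ x ≡ y mod p. This is solvable because y
  -- kills the kernel of W mod p, which is `h₂` divided by p.
  have hmem : φ ∘ y ∈ LinearMap.range (W.map φ)ᵀ.mulVecLin := by
    apply mem_range_transpose_mulVecLin
    intro z' hz'
    obtain ⟨z, rfl⟩ := hsurj z'
    have hz : ∀ i, (p : ℤ) ∣ (W *ᵥ z) i := by
      intro i
      have := congrFun hz' i
      rw [← RingHom.map_mulVec] at this
      exact (ZMod.intCast_zmod_eq_zero_iff_dvd _ _).1 this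
    have h3 := h₂ z hz
    rw [dotProduct_mulVec, ← mulVec_transpose, hyv, smul_dotProduct, pow_two, smul_eq_mul] at h3
    have h4 := Int.dvd_of_mul_dvd_mul_left hp0 h3
    rw [← RingHom.map_dotProduct]
    exact (ZMod.intCast_zmod_eq_zero_iff_dvd _ _).2 h4
  obtain ⟨x', hx'⟩ := hmem
  obtain ⟨x, rfl⟩ := hsurj x'
  refine ⟨v - (p : ℤ) • x, ?_, fun i => ?_⟩
  · ext i
    simp [φ]
  · have h5 : (p : ℤ) ∣ y i - (Wᵀ *ᵥ x) i := by
      have := congrFun hx' i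
      rw [mulVecLin_apply, ← transpose_map, ← RingHom.map_mulVec] at this
      refine (ZMod.intCast_zmod_eq_zero_iff_dvd _ _).1 ?_
      have h6 : φ (y i - (Wᵀ *ᵥ x) i) = 0 := by
        rw [map_sub, this, Function.comp_apply, sub_self]
      exact h6
    rw [mulVec_sub, mulVec_smul, hyv, pow_two]
    simp only [Pi.sub_apply, Pi.smul_apply, smul_eq_mul, ← mul_sub]
    exact mul_dvd_mul_left _ h5

end DetDivisibility

/-! ### The annihilator of e and the left kernel of the walk matrix. -/

section Annihilator

variable {n : ℕ} {F : Type*} [Field F]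

/-- The polynomials `g` with `g(A) e = 0` are the multiples of some nonzero polynomial. -/
theorem exists_walkMap_eq_zero_iff_dvd (A : Matrix (Fin n) (Fin n) F) :
    ∃ m : F[X], m ≠ 0 ∧ ∀ g, walkMap A g = 0 ↔ m ∣ g := by
  let I : Ideal F[X] :=
    { LinearMap.ker (walkMap A) with
      smul_mem' := fun c x hx => by
        have hx' : walkMap A x = 0 := hx
        change walkMap A (c * x) = 0
        rw [walkMap_mul, hx', mulVec_zero] }
  have hI : ∀ g, g ∈ I ↔ walkMap A g = 0 := fun _ => Iff.rfl
  obtain ⟨m, hm⟩ := (IsPrincipalIdealRing.principal I).principal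
  have key : ∀ g, walkMap A g = 0 ↔ m ∣ g := by
    intro g
    rw [← hI, hm, ← Ideal.span, Ideal.mem_span_singleton]
  refine ⟨m, ?_, key⟩
  rintro rfl
  have h : walkMap A A.charpoly = 0 := by
    rw [walkMap_apply, aeval_self_charpoly, zero_mulVec]
  exact A.charpoly_monic.ne_zero (zero_dvd_iff.1 ((key _).1 h))

theorem mem_ker_krylov_transpose (A : Matrix (Fin n) (Fin n) F) (x : Fin n → F) :
    x ∈ LinearMap.ker (krylov A)ᵀ.mulVecLin ↔ ∀ f, x ⬝ᵥ walkMap A f = 0 := by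
  rw [LinearMap.mem_ker, mulVecLin_apply]
  constructor
  · intro h f
    rw [walkMap_eq_krylov_mulVec, dotProduct_mulVec, ← mulVec_transpose, h, zero_dotProduct]
  · intro h
    apply dotProduct_eq_zero
    intro z
    rw [mulVec_transpose, ← dotProduct_mulVec, krylov_mulVec, h]

end Annihilator

/-! ### Reduction modulo p and the square divisibility. -/

section Reduction

theorem dvd_krylov_transpose_mulVec {n p : ℕ} (A : Matrix (Fin n) (Fin n) ℤ) (v : Fin n → ℤ)
    (h : ∀ f, (p : ℤ) ∣ v ⬝ᵥ walkMap A f) (i : Fin n) : (p : ℤ) ∣ ((krylov A)ᵀ *ᵥ v) i := by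
  have := h (X ^ (i : ℕ))
  rwa [walkMap_X_pow, dotProduct_comm] at this

variable {n : ℕ} {p : ℕ} [Fact p.Prime]

theorem intCast_comp_eq_zero_iff (x : Fin n → ℤ) :
    Int.castRingHom (ZMod p) ∘ x = 0 ↔ ∀ i, (p : ℤ) ∣ x i := by
  rw [funext_iff]
  exact forall_congr' fun i => ZMod.intCast_zmod_eq_zero_iff_dvd _ _

theorem exists_eq_add_of_comp_eq {x y : Fin n → ℤ}
    (h : Int.castRingHom (ZMod p) ∘ x = Int.castRingHom (ZMod p) ∘ y) :
    ∃ s : Fin n → ℤ, x = y + (p : ℤ) • s := by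
  have h' : ∀ i, (p : ℤ) ∣ x i - y i := fun i =>
    (ZMod.intCast_zmod_eq_zero_iff_dvd _ _).1 (by
      have := congrFun h i
      simpa [sub_eq_zero] using this)
  choose s hs using h'
  exact ⟨s, by ext i; simp [← hs]⟩

theorem exists_eq_add_of_polynomial_map_eq {f g : ℤ[X]}
    (h : f.map (Int.castRingHom (ZMod p)) = g.map (Int.castRingHom (ZMod p))) :
    ∃ r : ℤ[X], f = g + (p : ℤ) • r := by
  have h' : C (p : ℤ) ∣ f - g := by
    rw [C_dvd_iff_dvd_coeff]
    intro i
    refine (ZMod.intCast_zmod_eq_zero_iff_dvd _ _).1 ?_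
    have := congrArg (fun q => coeff q i) h
    simpa [sub_eq_zero] using this
  obtain ⟨r, hr⟩ := h'
  exact ⟨r, by rw [smul_eq_C_mul, ← hr]; ring⟩

theorem exists_polynomial_map_eq (f : (ZMod p)[X]) :
    ∃ g : ℤ[X], g.map (Int.castRingHom (ZMod p)) = f :=
  Polynomial.map_surjective _ ZMod.intCast_surjective f

variable (p) in
/-- The dimension of the left kernel of the walk matrix modulo `p`. -/
noncomputable def walkCorank (A : Matrix (Fin n) (Fin n) ℤ) : ℕ :=
  Module.finrank (ZMod p)
    (LinearMap.ker (krylov (A.map (Int.castRingHom (ZMod p))))ᵀ.mulVecLin)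

theorem intCast_dotProduct (x y : Fin n → ℤ) :
    (Int.castRingHom (ZMod p) ∘ x) ⬝ᵥ (Int.castRingHom (ZMod p) ∘ y) = 0 ↔
      (p : ℤ) ∣ x ⬝ᵥ y := by
  rw [← RingHom.map_dotProduct]
  exact ZMod.intCast_zmod_eq_zero_iff_dvd _ _

theorem mem_ker_krylov_map_transpose (A : Matrix (Fin n) (Fin n) ℤ) (v : Fin n → ℤ) :
    Int.castRingHom (ZMod p) ∘ v ∈
        LinearMap.ker (krylov (A.map (Int.castRingHom (ZMod p))))ᵀ.mulVecLin ↔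
      ∀ f, (p : ℤ) ∣ v ⬝ᵥ walkMap A f := by
  rw [mem_ker_krylov_transpose]
  constructor
  · intro h f
    rw [← intCast_dotProduct, ← walkMap_map, h]
  · intro h f
    obtain ⟨g, rfl⟩ := exists_polynomial_map_eq f
    rw [walkMap_map, intCast_dotProduct]
    exact h g

theorem pow_walkCorank_add_dvd_det (A : Matrix (Fin n) (Fin n) ℤ) (c : ℕ) (v : Fin n → ℤ)
    (hv : Int.castRingHom (ZMod p) ∘ v ≠ 0)
    (hWv : ∀ i, (p : ℤ) ^ (c + 1) ∣ ((krylov A)ᵀ *ᵥ v) i) :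
    (p : ℤ) ^ (walkCorank p A + c) ∣ (krylov A).det := by
  have := pow_finrank_ker_add_dvd_det (krylov A)ᵀ c v hv hWv
  rwa [det_transpose, transpose_map, ← krylov_map] at this

theorem pow_walkCorank_dvd_det (A : Matrix (Fin n) (Fin n) ℤ) (v : Fin n → ℤ)
    (hv : Int.castRingHom (ZMod p) ∘ v ≠ 0) (h : ∀ f, (p : ℤ) ∣ v ⬝ᵥ walkMap A f) :
    (p : ℤ) ^ walkCorank p A ∣ (krylov A).det := by
  have := pow_walkCorank_add_dvd_det A 0 v hv
    (by simpa using dvd_krylov_transpose_mulVec A v h)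
  simpa using this

theorem pow_walkCorank_succ_dvd_det (A : Matrix (Fin n) (Fin n) ℤ) (v : Fin n → ℤ)
    (hv : Int.castRingHom (ZMod p) ∘ v ≠ 0) (h₁ : ∀ f, (p : ℤ) ∣ v ⬝ᵥ walkMap A f)
    (h₂ : ∀ g, Int.castRingHom (ZMod p) ∘ walkMap A g = 0 → (p : ℤ) ^ 2 ∣ v ⬝ᵥ walkMap A g) :
    (p : ℤ) ^ (walkCorank p A + 1) ∣ (krylov A).det := by
  obtain ⟨v', hv', hWv'⟩ := exists_lift_transpose_mulVec (p := p) (krylov A) v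
    (dvd_krylov_transpose_mulVec A v h₁) (fun z hz => by
      rw [krylov_mulVec] at hz ⊢
      exact h₂ _ ((intCast_comp_eq_zero_iff _).2 hz))
  exact pow_walkCorank_add_dvd_det A 1 v' (by rwa [hv']) hWv'

/-- If the walk matrix of a symmetric matrix has an isotropic left kernel vector modulo `p`, in the
strong sense below, then `p ^ 2` divides its determinant. -/
theorem sq_dvd_det_krylov {A : Matrix (Fin n) (Fin n) ℤ} (hA : A.IsSymm) (u : Fin n → ℤ)
    (hu : Int.castRingHom (ZMod p) ∘ u ≠ 0) (h₁ : ∀ f, (p : ℤ) ∣ u ⬝ᵥ walkMap A f)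
    (h₂ : ∀ f : ℤ[X], (p : ℤ) ^ 2 ∣ u ⬝ᵥ (aeval A f *ᵥ u)) :
    (p : ℤ) ^ 2 ∣ (krylov A).det := by
  by_contra hdet
  have hk1 : walkCorank p A ≤ 1 := by
    by_contra hk
    exact hdet ((pow_dvd_pow _ (by omega)).trans (pow_walkCorank_dvd_det A u hu h₁))
  set φ := Int.castRingHom (ZMod p) with hφ
  have hAs : (A.map φ).IsSymm := hA.map φ
  set K := LinearMap.ker (krylov (A.map φ))ᵀ.mulVecLin with hK
  have huK : φ ∘ u ∈ K := (mem_ker_krylov_map_transpose A u).2 h₁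
  have hu0 : (⟨φ ∘ u, huK⟩ : K) ≠ 0 := fun h => hu (congrArg Subtype.val h)
  have hk : Module.finrank (ZMod p) K = 1 := by
    have : Nontrivial K := nontrivial_of_ne _ _ hu0
    exact le_antisymm hk1 Module.finrank_pos
  have hline : ∀ x ∈ K, ∃ c : ZMod p, c • (φ ∘ u) = x := by
    intro x hx
    obtain ⟨c, hc⟩ := (finrank_eq_one_iff_of_nonzero' _ hu0).1 hk ⟨x, hx⟩
    exact ⟨c, congrArg Subtype.val hc⟩
  have huu : (φ ∘ u) ⬝ᵥ (φ ∘ u) = 0 := by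
    rw [intCast_dotProduct]
    have := h₂ 1
    rw [map_one, one_mulVec] at this
    exact (dvd_pow_self _ two_ne_zero).trans this
  obtain ⟨m, hm0, hm⟩ := exists_walkMap_eq_zero_iff_dvd (A.map φ)
  -- The left kernel is the line through u, and u·u ≡ 0, so u is orthogonal to that kernel and hence
  -- is a walk vector.
  obtain ⟨f, hfu, hfdeg⟩ : ∃ f, walkMap (A.map φ) f = φ ∘ u ∧ f.degree < m.degree := by
    have hmem : φ ∘ u ∈ LinearMap.range (krylov (A.map φ))ᵀᵀ.mulVecLin := by
      apply mem_range_transpose_mulVecLin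
      intro z hz
      obtain ⟨c, rfl⟩ := hline z hz
      rw [dotProduct_smul, huu, smul_zero]
    rw [transpose_transpose, ← range_walkMap] at hmem
    obtain ⟨f, hf⟩ := hmem
    refine ⟨f % m, ?_, EuclideanDomain.mod_lt _ hm0⟩
    rw [← hf, ← sub_eq_zero, ← map_sub, hm, EuclideanDomain.mod_eq_sub_mul_div]
    exact ⟨-(f / m), by ring⟩
  -- The left kernel is A-invariant by symmetry, so u is an eigenvector mod p.
  obtain ⟨l, hl⟩ := hline (A.map φ *ᵥ (φ ∘ u)) (by
    rw [hK, mem_ker_krylov_transpose]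
    intro g
    have h := (mem_ker_krylov_transpose _ _).1 huK (X * g)
    rwa [walkMap_mul, aeval_X, ← hAs.mulVec_dotProduct] at h)
  have hker : walkMap (A.map φ) ((X - C l) * f) = 0 := by
    rw [walkMap_mul, hfu, map_sub, aeval_X, aeval_C, sub_mulVec, ← hl,
      Algebra.algebraMap_eq_smul_one, smul_mulVec, one_mulVec, sub_self]
  obtain ⟨q, hq⟩ := (hm _).1 hker
  have hf0 : f ≠ 0 := by
    rintro rfl
    exact hu (by rw [← hfu, map_zero])
  have hq0 : q ≠ 0 := by
    rintro rfl
    rw [mul_zero] at hq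
    exact (mul_ne_zero (X_sub_C_ne_zero l) hf0) hq
  -- Since f has smaller degree than m, (X - l) f = m q forces q to be a constant: f divides m.
  obtain ⟨a, ha, rfl⟩ : ∃ a : ZMod p, a ≠ 0 ∧ q = C a := by
    have h := congrArg natDegree hq
    rw [natDegree_mul (X_sub_C_ne_zero l) hf0, natDegree_mul hm0 hq0, natDegree_X_sub_C] at h
    have h' := natDegree_lt_natDegree hf0 hfdeg
    have hq' : q = C (q.coeff 0) := eq_C_of_natDegree_eq_zero (by omega)
    refine ⟨_, fun h0 => hq0 ?_, hq'⟩
    rw [hq', h0, C_0]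
  have hk2 : 2 ≤ walkCorank p A + 1 := by
    have : walkCorank p A = 1 := hk
    omega
  refine hdet ((pow_dvd_pow _ hk2).trans
    (pow_walkCorank_succ_dvd_det A u hu h₁ fun g hg => ?_))
  rw [← hφ, ← walkMap_map, hm] at hg
  obtain ⟨h', hgh'⟩ := hg
  obtain ⟨f₀, rfl⟩ := exists_polynomial_map_eq f
  obtain ⟨t, ht⟩ := exists_polynomial_map_eq ((X - C l) * (C a⁻¹ * h'))
  -- Thus g(A)e ≡ t(A)u mod p, and t(A)u ≡ 0 mod p because t contains X - l. Expanding u·g(A)e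
  -- leaves only multiples of p².
  obtain ⟨r, hr⟩ : ∃ r, g = t * f₀ + (p : ℤ) • r := by
    apply exists_eq_add_of_polynomial_map_eq
    rw [Polynomial.map_mul, ht, hgh']
    have hinv : C a * C a⁻¹ = (1 : (ZMod p)[X]) := by rw [← C_mul, mul_inv_cancel₀ ha, C_1]
    linear_combination (-m * h') * hinv - C a⁻¹ * h' * hq
  obtain ⟨s, hs⟩ : ∃ s, walkMap A f₀ = u + (p : ℤ) • s := by
    apply exists_eq_add_of_comp_eq
    rw [← walkMap_map]
    exact hfu
  have htu : ∀ i, (p : ℤ) ∣ (aeval A t *ᵥ u) i := by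
    rw [← intCast_comp_eq_zero_iff, map_aeval_mulVec, ← hφ, ht, ← hfu, ← walkMap_mul, hm]
    exact ⟨h', by linear_combination C a⁻¹ * h' * hq + m * h' * (by
      rw [← C_mul, mul_inv_cancel₀ ha, C_1] : C a * C a⁻¹ = (1 : (ZMod p)[X]))⟩
  rw [hr, map_add, map_smul, walkMap_mul, hs, mulVec_add, mulVec_smul, dotProduct_add,
    dotProduct_add, dotProduct_smul, dotProduct_smul, ← (hA.aeval t).mulVec_dotProduct u s,
    pow_two, smul_eq_mul, smul_eq_mul, ← pow_two]
  refine dvd_add (dvd_add (h₂ t) ?_) ?_ <;> rw [pow_two]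
  · exact mul_dvd_mul_left _ (Finset.dvd_sum fun i _ => Dvd.dvd.mul_right (htu i) _)
  · exact mul_dvd_mul_left _ (h₁ r)

end Reduction

/-! ### Alternating matrices over the field with two elements. -/

section ZModTwo

variable {n : ℕ} {B : Matrix (Fin n) (Fin n) (ZMod 2)}

theorem IsSymm.dotProduct_mulVec_self_zmod_two (hB : B.IsSymm) (hd : ∀ i, B i i = 0)
    (x : Fin n → ZMod 2) : x ⬝ᵥ (B *ᵥ x) = 0 := by
  simp only [dotProduct, mulVec, Finset.mul_sum]
  rw [← Finset.sum_product' Finset.univ Finset.univ (fun i j => x i * (B i j * x j))]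
  refine Finset.sum_involution (fun a _ => a.swap) ?_ ?_ ?_ ?_
  · rintro ⟨i, j⟩ -
    have : x j * (B j i * x i) = x i * (B i j * x j) := by
      rw [hB.apply i j]; ring
    simp only [Prod.fst_swap, Prod.snd_swap, this]
    exact CharTwo.add_self_eq_zero _
  · rintro ⟨i, j⟩ - h heq
    have hij : j = i := congrArg Prod.fst heq
    subst hij
    exact h (by simp [hd])
  · simp
  · simp

/-- For k = 2j the count is x·x with x = B^j e, and x·x = e·x mod 2 halves the exponent; for k = 2j
+ 1 it is x·Bx, which vanishes since B is alternating. -/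
theorem IsSymm.sum_walk_zmod_two (hB : B.IsSymm) (hd : ∀ i, B i i = 0) (k : ℕ) (hk : 0 < k) :
    (fun _ => 1) ⬝ᵥ walkMap B (X ^ k) = 0 := by
  induction k using Nat.strong_induction_on with
  | _ k ih =>
    obtain ⟨j, rfl | rfl⟩ := Nat.even_or_odd' k
    · rw [two_mul, pow_add, ← hB.walkMap_dotProduct]
      have hsq : ∀ x : Fin n → ZMod 2, x ⬝ᵥ x = (fun _ => 1) ⬝ᵥ x := by
        intro x
        refine Finset.sum_congr rfl fun i _ => ?_
        have : ∀ a : ZMod 2, a * a = 1 * a := by decide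
        exact this _
      rw [hsq]
      exact ih j (by omega) (by omega)
    · rw [show (X : (ZMod 2)[X]) ^ (2 * j + 1) = X ^ j * (X * X ^ j) by ring,
        ← hB.walkMap_dotProduct, walkMap_mul, aeval_X]
      exact hB.dotProduct_mulVec_self_zmod_two hd _

theorem IsSymm.sum_walkMap_zmod_two (hB : B.IsSymm) (hd : ∀ i, B i i = 0) (f : (ZMod 2)[X]) :
    (fun _ => 1) ⬝ᵥ walkMap B f = f.coeff 0 * n := by
  induction f using Polynomial.induction_on' with
  | add p q hp hq => rw [map_add, dotProduct_add, hp, hq, coeff_add, add_mul]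
  | monomial k a =>
    rw [← C_mul_X_pow_eq_monomial, ← smul_eq_C_mul, map_smul, dotProduct_smul]
    rcases Nat.eq_zero_or_pos k with rfl | hk
    · simp [walkMap_one, dotProduct]
    · simp [hB.sum_walk_zmod_two hd k hk, hk.ne]

/-- The pairing of f(B)e with g(B)e is f(0) g(0) n, so orthogonality to e alone gives orthogonality
to every walk vector. -/
theorem IsSymm.mem_ker_of_sum_eq_zero (hB : B.IsSymm) (hd : ∀ i, B i i = 0) (f : (ZMod 2)[X])
    (hf : (fun _ => 1) ⬝ᵥ walkMap B f = 0) :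
    walkMap B f ∈ LinearMap.ker (krylov B)ᵀ.mulVecLin := by
  rw [mem_ker_krylov_transpose]
  intro g
  rw [hB.walkMap_dotProduct]
  rw [hB.sum_walkMap_zmod_two hd] at hf ⊢
  rw [mul_coeff_zero, mul_right_comm, hf, zero_mul]

theorem finrank_range_add_finrank_ker_transpose (M : Matrix (Fin n) (Fin n) (ZMod 2)) :
    Module.finrank (ZMod 2) (LinearMap.range M.mulVecLin) +
      Module.finrank (ZMod 2) (LinearMap.ker Mᵀ.mulVecLin) = n := by
  have h := LinearMap.finrank_range_add_finrank_ker Mᵀ.mulVecLin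
  have h' : Mᵀ.rank = M.rank := rank_transpose M
  rw [rank, rank] at h'
  rw [h', Module.finrank_pi, Fintype.card_fin] at h
  exact h

/-- The part of the column space orthogonal to e lies in the left kernel; it is everything for even
n and has codimension at most one for odd n. -/
theorem IsSymm.finrank_range_le_zmod_two (hB : B.IsSymm) (hd : ∀ i, B i i = 0) :
    Module.finrank (ZMod 2) (LinearMap.range (krylov B).mulVecLin) ≤
      Module.finrank (ZMod 2) (LinearMap.ker (krylov B)ᵀ.mulVecLin ⊓
        LinearMap.range (krylov B).mulVecLin : Submodule _ _) + n % 2 := by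
  set V := LinearMap.range (krylov B).mulVecLin with hV
  set K := LinearMap.ker (krylov B)ᵀ.mulVecLin with hK
  have hmem : ∀ x ∈ V, (fun _ => 1) ⬝ᵥ x = 0 → x ∈ K := by
    intro x hx h0
    rw [hV, ← range_walkMap] at hx
    obtain ⟨f, rfl⟩ := hx
    exact hB.mem_ker_of_sum_eq_zero hd f h0
  rcases Nat.even_or_odd n with hn | hn
  · have : V ≤ K ⊓ V := by
      refine le_inf (fun x hx => hmem x hx ?_) le_rfl
      rw [hV, ← range_walkMap] at hx
      obtain ⟨f, rfl⟩ := hx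
      rw [hB.sum_walkMap_zmod_two hd, (ZMod.natCast_eq_zero_iff_even).2 hn, mul_zero]
    exact (Submodule.finrank_mono this).trans (Nat.le_add_right _ _)
  · rw [Nat.odd_iff.1 hn]
    let ψ : V →ₗ[ZMod 2] ZMod 2 := (dotProductEquiv (ZMod 2) (Fin n) (fun _ => 1)).comp V.subtype
    have h1 := LinearMap.finrank_range_add_finrank_ker ψ
    have h2 : Module.finrank (ZMod 2) (LinearMap.range ψ) ≤ 1 :=
      (Submodule.finrank_le _).trans (Module.finrank_self _).le
    have h3 : (LinearMap.ker ψ).map V.subtype ≤ K ⊓ V := by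
      rintro _ ⟨⟨x, hx⟩, h0, rfl⟩
      exact ⟨hmem x hx h0, hx⟩
    have h4 := Submodule.finrank_mono h3
    rw [Submodule.finrank_map_subtype_eq] at h4
    omega

theorem IsSymm.ker_le_range_zmod_two (hB : B.IsSymm) (hd : ∀ i, B i i = 0)
    (hk : Module.finrank (ZMod 2) (LinearMap.ker (krylov B)ᵀ.mulVecLin) ≤ n / 2) :
    LinearMap.ker (krylov B)ᵀ.mulVecLin ≤ LinearMap.range (krylov B).mulVecLin := by
  have h1 := finrank_range_add_finrank_ker_transpose (krylov B)
  have h2 := hB.finrank_range_le_zmod_two hd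
  have h3 := Submodule.eq_of_le_of_finrank_le
    (inf_le_left : LinearMap.ker (krylov B)ᵀ.mulVecLin ⊓
      LinearMap.range (krylov B).mulVecLin ≤ _) (by omega)
  exact inf_eq_left.1 h3

theorem IsSymm.half_le_finrank_ker (hB : B.IsSymm) (hd : ∀ i, B i i = 0) :
    n / 2 ≤ Module.finrank (ZMod 2) (LinearMap.ker (krylov B)ᵀ.mulVecLin) := by
  have h1 := finrank_range_add_finrank_ker_transpose (krylov B)
  have h2 := hB.finrank_range_le_zmod_two hd
  have h3 := Submodule.finrank_mono (inf_le_left : LinearMap.ker (krylov B)ᵀ.mulVecLin ⊓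
      LinearMap.range (krylov B).mulVecLin ≤ _)
  omega

end ZModTwo

/-! ### The extra factor 2. -/

section Two

variable {n : ℕ} {A : Matrix (Fin n) (Fin n) ℤ}

/-- An isotropic left kernel vector modulo `2`, in the strong sense below, of the walk matrix of a
symmetric matrix with zero diagonal forces an extra factor `2` in its determinant. -/
theorem two_pow_dvd_det_krylov (hA : A.IsSymm) (hd : ∀ i, A i i = 0) (u : Fin n → ℤ)
    (hu : Int.castRingHom (ZMod 2) ∘ u ≠ 0) (h₁ : ∀ f, 2 ∣ u ⬝ᵥ walkMap A f)
    (h₂ : ∀ f : ℤ[X], 4 ∣ u ⬝ᵥ (aeval A f *ᵥ u)) :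
    2 ^ (n / 2 + 1) ∣ (krylov A).det := by
  classical
  have hk0 := pow_walkCorank_dvd_det (p := 2) A u hu h₁
  by_cases hk : n / 2 < walkCorank 2 A
  · exact (pow_dvd_pow _ hk).trans hk0
  set φ := Int.castRingHom (ZMod 2) with hφ
  have hAs : (A.map φ).IsSymm := hA.map φ
  have hAd : ∀ i, A.map φ i i = 0 := fun i => by rw [map_apply, hd, map_zero]
  have hhalf : n / 2 ≤ walkCorank 2 A := hAs.half_le_finrank_ker hAd
  have hker := hAs.ker_le_range_zmod_two hAd (not_lt.1 hk)
  obtain ⟨f', hf'⟩ : φ ∘ u ∈ LinearMap.range (walkMap (A.map φ)) := by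
    rw [range_walkMap]
    exact hker ((mem_ker_krylov_map_transpose A u).2 h₁)
  obtain ⟨m', hm0, hm'⟩ := exists_walkMap_eq_zero_iff_dvd (A.map φ)
  -- Here the corank may be large, so f need not divide m. Replacing f by d = gcd(f, m) restores
  -- this, and d(A)e takes the role of u.
  obtain ⟨q', hq'⟩ := EuclideanDomain.gcd_dvd_right f' m'
  have hgcd := EuclideanDomain.gcd_eq_gcd_ab f' m'
  obtain ⟨f, hf⟩ := exists_polynomial_map_eq f'
  obtain ⟨m, hm⟩ := exists_polynomial_map_eq m'
  obtain ⟨q, hq⟩ := exists_polynomial_map_eq q'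
  obtain ⟨a, ha⟩ := exists_polynomial_map_eq (EuclideanDomain.gcdA f' m')
  obtain ⟨b, hb⟩ := exists_polynomial_map_eq (EuclideanDomain.gcdB f' m')
  have hdmap : (f * a + m * b).map φ = EuclideanDomain.gcd f' m' := by
    rw [hgcd, Polynomial.map_add, Polynomial.map_mul, Polynomial.map_mul, hf, hm, ha, hb]
  obtain ⟨r, hr⟩ : ∃ r, m = (f * a + m * b) * q + (2 : ℤ) • r := by
    apply exists_eq_add_of_polynomial_map_eq (p := 2)
    rw [Polynomial.map_mul, hdmap, hm, hq]
    exact hq'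
  obtain ⟨s, hs⟩ : ∃ s, walkMap A f = u + (2 : ℤ) • s := by
    apply exists_eq_add_of_comp_eq (p := 2)
    rw [← walkMap_map, ← hφ, hf]
    exact hf'
  obtain ⟨t, ht⟩ : ∃ t, walkMap A m = (2 : ℤ) • t := by
    obtain ⟨t, ht⟩ : ∃ t, walkMap A m = 0 + (2 : ℤ) • t := by
      apply exists_eq_add_of_comp_eq (p := 2)
      rw [← walkMap_map, ← hφ, hm, (hm' _).2 dvd_rfl]
      ext; simp
    exact ⟨t, by rw [ht, zero_add]⟩
  let τ : ℤ[X] →ₗ[ℤ] ℤ := (dotProductEquiv ℤ (Fin n) (fun _ => 1)).comp (walkMap A)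
  have hτ : ∀ g h, τ (g * h) = walkMap A g ⬝ᵥ walkMap A h := fun g h =>
    (hA.walkMap_dotProduct g h).symm
  have hJf : ∀ h, 2 ∣ τ (f * h) := by
    intro h
    rw [hτ, hs, add_dotProduct, smul_dotProduct, smul_eq_mul]
    exact dvd_add (h₁ h) (dvd_mul_right _ _)
  have hJm : ∀ h, 2 ∣ τ (m * h) := by
    intro h
    rw [hτ, ht, smul_dotProduct, smul_eq_mul]
    exact dvd_mul_right _ _
  -- Passing from f(A)e to u costs a cross term that symmetry of A doubles, so it is divisible by 4.
  have hKf : ∀ h, 4 ∣ τ (f * (h * f)) := by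
    intro h
    rw [hτ, walkMap_mul, hs, mulVec_add, mulVec_smul, dotProduct_add, add_dotProduct,
      add_dotProduct, dotProduct_smul, dotProduct_smul, smul_dotProduct, smul_dotProduct,
      ← (hA.aeval h).mulVec_dotProduct u s, dotProduct_comm _ s]
    simp only [smul_eq_mul]
    obtain ⟨c, hc⟩ := h₂ h
    exact ⟨c + s ⬝ᵥ aeval A h *ᵥ u + s ⬝ᵥ aeval A h *ᵥ s, by linear_combination hc⟩
  have hKm : ∀ h, 4 ∣ τ (m * (h * m)) := by
    intro h
    rw [hτ, walkMap_mul, ht, mulVec_smul, dotProduct_smul, smul_dotProduct]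
    simp only [smul_eq_mul]
    exact ⟨_, by ring⟩
  have hJd : ∀ h, 2 ∣ τ ((f * a + m * b) * h) := by
    intro h
    rw [show (f * a + m * b) * h = f * (a * h) + m * (b * h) by ring, map_add]
    exact dvd_add (hJf _) (hJm _)
  have hKdm : ∀ h, 4 ∣ τ ((f * a + m * b) * (m * h)) := by
    intro h
    -- Substitute m = d q + 2 r and expand d² = (f a + m b)²; the mixed term has a factor 2.
    have e : (f * a + m * b) * (m * h) = f * ((a ^ 2 * q * h) * f) + m * ((b ^ 2 * q * h) * m) +
        (2 : ℤ) • (f * (m * a * b * q * h) + (f * a + m * b) * (r * h)) := by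
      rw [smul_eq_C_mul] at hr ⊢
      have hC : (C 2 : ℤ[X]) = 2 := rfl
      rw [hC] at hr ⊢
      linear_combination (f * a + m * b) * h * hr
    rw [e, map_add, map_add, map_smul, map_add]
    refine dvd_add (dvd_add (hKf _) (hKm _)) ?_
    rw [smul_eq_mul, show (4 : ℤ) = 2 * 2 by norm_num]
    exact mul_dvd_mul_left _ (dvd_add (hJf _) (hJd _))
  refine (pow_dvd_pow (2 : ℤ) (Nat.succ_le_succ hhalf)).trans
    (pow_walkCorank_succ_dvd_det (p := 2) A (walkMap A (f * a + m * b)) ?_ ?_ ?_)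
  · rw [← walkMap_map, ← hφ, hdmap, Ne, hm']
    intro hdvd
    apply hu
    rw [← hf', hm']
    exact hdvd.trans (EuclideanDomain.gcd_dvd_left f' m')
  · intro h
    rw [← hτ]
    exact hJd h
  · intro g hg
    rw [← walkMap_map, ← hφ, hm'] at hg
    obtain ⟨h', hh'⟩ := hg
    obtain ⟨h, rfl⟩ := exists_polynomial_map_eq h'
    obtain ⟨c, rfl⟩ : ∃ c, g = m * h + (2 : ℤ) • c := by
      apply exists_eq_add_of_polynomial_map_eq (p := 2)
      rw [Polynomial.map_mul, hm]
      exact hh'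
    rw [← hτ, mul_add, mul_smul_comm, map_add, map_smul]
    refine dvd_add (hKdm h) ?_
    rw [smul_eq_mul, pow_two]
    exact mul_dvd_mul_left _ (hJd _)

end Two

/-! ### Walk counts from characteristic polynomials. -/

section Charpoly

variable {n : ℕ}

theorem charpoly_neg_eq {R : Type*} [CommRing R] (M : Matrix (Fin n) (Fin n) R) :
    (-M).charpoly = (-1) ^ n * M.charpoly.comp (-X) := by
  have h : M.charpoly.comp (-X) = (-(charmatrix (-M))).det := by
    rw [charpoly, ← coe_compRingHom_apply, RingHom.map_det]
    congr 1
    ext i j : 2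
    by_cases hij : i = j
    · subst hij
      simp [charmatrix_apply_eq]
      ring
    · simp [charmatrix_apply_ne _ _ _ hij]
  rw [h, det_neg, Fintype.card_fin, ← mul_assoc, ← mul_pow, neg_one_mul, neg_neg, one_pow, one_mul,
    charpoly]

theorem det_add_vecMulVec_of_ne_zero {K : Type*} [Field K] {N : Matrix (Fin n) (Fin n) K}
    (hN : N.det ≠ 0) (x y : Fin n → K) :
    (N + vecMulVec x y).det = N.det + y ⬝ᵥ (N.adjugate *ᵥ x) := by
  have h := det_add_replicateCol_mul_replicateRow (ι := Unit) (isUnit_iff_ne_zero.2 hN) x y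
  rw [← vecMulVec_eq] at h
  rw [h, det_unique (n := Unit), add_apply, one_apply_eq, Matrix.mul_assoc, ← replicateCol_mulVec,
    replicateRow_mul_replicateCol_apply, inv_def, smul_mulVec, dotProduct_smul, mul_add, mul_one,
    Ring.inverse_eq_inv', smul_eq_mul, mul_inv_cancel_left₀ hN]

/-- Passing to the fraction field lets this apply to X - A, whose determinant is nonzero but need
not be a unit. -/
theorem det_add_vecMulVec {R : Type*} [CommRing R] [IsDomain R] {N : Matrix (Fin n) (Fin n) R}
    (hN : N.det ≠ 0) (x y : Fin n → R) :
    (N + vecMulVec x y).det = N.det + y ⬝ᵥ (N.adjugate *ᵥ x) := by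
  let ι := algebraMap R (FractionRing R)
  have hι : Function.Injective ι := IsFractionRing.injective R (FractionRing R)
  apply hι
  have h := det_add_vecMulVec_of_ne_zero (N := ι.mapMatrix N)
    (by rw [← RingHom.map_det]; exact (map_ne_zero_iff ι hι).2 hN) (ι ∘ x) (ι ∘ y)
  rw [map_add, RingHom.map_det, RingHom.map_det, RingHom.map_dotProduct]
  have e1 : ι.mapMatrix (N + vecMulVec x y) = ι.mapMatrix N + vecMulVec (ι ∘ x) (ι ∘ y) := by
    ext i j
    simp [vecMulVec_apply]
  have e2 : (ι ∘ (N.adjugate *ᵥ x)) = (ι.mapMatrix N).adjugate *ᵥ (ι ∘ x) := by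
    ext i
    rw [← RingHom.map_adjugate, Function.comp_apply, RingHom.map_mulVec]
    rfl
  rw [e1, h, e2]

theorem degree_adjugate_charmatrix_lt {R : Type*} [CommRing R] (M : Matrix (Fin n) (Fin n) R)
    (i j : Fin n) : (adjugate (charmatrix M) i j).degree < n := by
  -- Row j contains no X, so the coefficient of X^n is the determinant of a matrix with a zero row.
  have e : (charmatrix M).updateRow j (Pi.single i 1) =
      (X : R[X]) • ((1 : Matrix (Fin n) (Fin n) R).updateRow j 0).map C +
        ((-M).updateRow j (Pi.single i 1)).map C := by
    ext k l : 2
    by_cases hk : k = j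
    · subst hk
      by_cases hl : l = i
      · subst hl; simp
      · simp [hl]
    · by_cases hkl : k = l
      · subst hkl
        simp [hk, charmatrix_apply_eq, sub_eq_add_neg]
      · simp [hk, hkl]
  rw [adjugate_apply, e, degree_lt_iff_coeff_zero]
  intro m hm
  rcases hm.eq_or_lt with rfl | hm
  · have := coeff_det_X_add_C_card ((1 : Matrix (Fin n) (Fin n) R).updateRow j 0)
      ((-M).updateRow j (Pi.single i 1))
    rw [Fintype.card_fin] at this
    rw [this]
    exact det_eq_zero_of_row_eq_zero j (by simp)
  · apply coeff_eq_zero_of_natDegree_lt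
    refine lt_of_le_of_lt (natDegree_det_X_add_C_le _ _) ?_
    rwa [Fintype.card_fin]

/-- The generating polynomials `e · A ^ k adj(X - A) e` of the walk counts of `A`. -/
noncomputable def walkPoly {R : Type*} [CommRing R] (A : Matrix (Fin n) (Fin n) R) (k : ℕ) : R[X] :=
  (fun _ => 1) ⬝ᵥ ((A ^ k).map C *ᵥ ((charmatrix A).adjugate *ᵥ (fun _ => 1)))

theorem degree_walkPoly_lt {R : Type*} [CommRing R] (A : Matrix (Fin n) (Fin n) R) (k : ℕ) :
    (walkPoly A k).degree < n := by
  have hsum : ∀ g : Fin n → R[X], (∀ i, (g i).degree < n) → (∑ i, g i).degree < n := by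
    intro g hg
    simp_rw [← mem_degreeLT] at hg ⊢
    exact Submodule.sum_mem _ fun i _ => hg i
  refine hsum _ fun i => ?_
  rw [one_mul]
  refine hsum _ fun j => ?_
  refine lt_of_le_of_lt ?_ (hsum _ (fun l => ?_) : (((charmatrix A).adjugate *ᵥ
    (fun _ => 1)) j).degree < n)
  · change (C ((A ^ k) i j) * ((charmatrix A).adjugate *ᵥ (fun _ => 1)) j).degree ≤
      (((charmatrix A).adjugate *ᵥ (fun _ => 1)) j).degree
    rw [← smul_eq_C_mul]
    exact degree_smul_le _ _
  · rw [mul_one]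
    exact degree_adjugate_charmatrix_lt A j l

/-- This is (X - A) adj(X - A) = χ_A paired with e on one side and A^k e on the other. As walk
polynomials have degree below n, the coefficient of X^n reads off the walk count, so χ_A and
`walkPoly A 0` determine all counts. -/
theorem X_mul_walkPoly {R : Type*} [CommRing R] (A : Matrix (Fin n) (Fin n) R) (k : ℕ) :
    X * walkPoly A k - walkPoly A (k + 1) =
      A.charpoly * C ((fun _ => 1) ⬝ᵥ ((A ^ k) *ᵥ (fun _ => 1))) := by
  set w := (charmatrix A).adjugate *ᵥ (fun _ => (1 : R[X])) with hw
  have h1 : (X : R[X]) • w - A.map (C : R →+* R[X]) *ᵥ w = A.charpoly • (fun _ => (1 : R[X])) := by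
    have : charmatrix A *ᵥ w = A.charpoly • (fun _ => (1 : R[X])) := by
      rw [hw, mulVec_mulVec, mul_adjugate, smul_mulVec, one_mulVec, charpoly]
    rw [← this, charmatrix, sub_mulVec]
    congr 1
    ext i
    simp [scalar_apply, mulVec_diagonal]
  have h2 : walkPoly A (k + 1) = (fun _ => 1) ⬝ᵥ ((A ^ k).map C *ᵥ (A.map C *ᵥ w)) := by
    rw [walkPoly, ← hw, pow_succ, Matrix.map_mul, ← mulVec_mulVec]
  rw [h2, walkPoly, ← hw, ← smul_eq_mul, ← dotProduct_smul, ← mulVec_smul, ← dotProduct_sub,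
    ← mulVec_sub, h1, mulVec_smul, dotProduct_smul, smul_eq_mul]
  simp [dotProduct, mulVec, map_sum]

theorem coeff_X_mul_walkPoly {R : Type*} [CommRing R] [Nontrivial R] (A : Matrix (Fin n) (Fin n) R)
    (k : ℕ) : (X * walkPoly A k).coeff n = (fun _ => 1) ⬝ᵥ ((A ^ k) *ᵥ (fun _ => 1)) := by
  have h := congrArg (fun q => coeff q n) (X_mul_walkPoly A k)
  simp only [coeff_sub, coeff_mul_C] at h
  have h1 : A.charpoly.coeff n = 1 := by
    have := A.charpoly_monic.coeff_natDegree
    rwa [charpoly_natDegree_eq_dim, Fintype.card_fin] at this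
  rw [h1, one_mul, coeff_eq_zero_of_degree_lt (degree_walkPoly_lt A (k + 1)), sub_zero] at h
  exact h

theorem walkPoly_zero {R : Type*} [CommRing R] [IsDomain R] (A : Matrix (Fin n) (Fin n) R) :
    walkPoly A 0 = (A - of 1).charpoly - A.charpoly := by
  have h := det_add_vecMulVec (N := charmatrix A) A.charpoly_monic.ne_zero
    (fun _ => 1) (fun _ => 1)
  have e : charmatrix A + vecMulVec (fun _ => 1) (fun _ => 1) = charmatrix (A - of 1) := by
    ext i j : 2
    by_cases hij : i = j
    · subst hij
      simp [charmatrix_apply_eq, vecMulVec_apply]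
      ring
    · simp [charmatrix_apply_ne _ _ _ hij, vecMulVec_apply]
      ring
  rw [charpoly, ← e, h, charpoly, add_sub_cancel_left, walkPoly, pow_zero]
  congr 1
  have : (1 : Matrix (Fin n) (Fin n) R).map C = 1 := by simp
  rw [this, one_mulVec]

/-- The walk counts `e · A ^ k e` are determined by the characteristic polynomials of `A` and of
`J - I - A`, where `J` is the all-one matrix. -/
theorem sum_walk_eq_of_charpoly_eq {R : Type*} [CommRing R] [IsDomain R]
    {A B : Matrix (Fin n) (Fin n) R} (h : A.charpoly = B.charpoly)
    (hc : (of 1 - 1 - A).charpoly = (of 1 - 1 - B).charpoly) (k : ℕ) :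
    (fun _ => 1) ⬝ᵥ ((A ^ k) *ᵥ (fun _ => 1)) = (fun _ => 1) ⬝ᵥ ((B ^ k) *ᵥ (fun _ => 1)) := by
  -- M - J = -((J - I - M) + I): a shift followed by a sign change.
  have hJ : ∀ M : Matrix (Fin n) (Fin n) R, (M - of 1).charpoly =
      (-1) ^ n * ((of 1 - 1 - M).charpoly.comp (X + C (-1))).comp (-X) := by
    intro M
    rw [← charpoly_sub_scalar, ← charpoly_neg_eq]
    congr 1
    rw [map_neg, map_one (scalar (Fin n))]
    abel
  have key : ∀ k, walkPoly A k = walkPoly B k := by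
    intro k
    induction k with
    | zero => rw [walkPoly_zero, walkPoly_zero, hJ A, hJ B, h, hc]
    | succ k ih =>
      have hA := X_mul_walkPoly A k
      have hB := X_mul_walkPoly B k
      rw [← coeff_X_mul_walkPoly, ih, h] at hA
      rw [← coeff_X_mul_walkPoly, ← hA] at hB
      exact (sub_right_injective hB).symm
  rw [← coeff_X_mul_walkPoly, key, coeff_X_mul_walkPoly]

end Charpoly

/-! ### The transition matrix between two walk matrices. -/

section Transition

variable {n : ℕ} {A B U : Matrix (Fin n) (Fin n) ℤ}

theorem krylov_transpose_mul_krylov (hA : A.IsSymm) (hB : B.IsSymm)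
    (h : ∀ k, (fun _ => 1) ⬝ᵥ ((A ^ k) *ᵥ (fun _ => 1)) =
      (fun _ => 1) ⬝ᵥ ((B ^ k) *ᵥ (fun _ => 1))) :
    (krylov A)ᵀ * krylov A = (krylov B)ᵀ * krylov B := by
  have key : ∀ {M : Matrix (Fin n) (Fin n) ℤ}, M.IsSymm → ∀ i j, ((krylov M)ᵀ * krylov M) i j =
      (fun _ => 1) ⬝ᵥ ((M ^ (i + j : ℕ)) *ᵥ (fun _ => 1)) := by
    intro M hM i j
    rw [← walkMap_X_pow, pow_add, ← hM.walkMap_dotProduct, walkMap_X_pow, walkMap_X_pow]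
    rfl
  ext i j
  rw [key hA, key hB, h]

theorem mul_left_cancel_of_det_ne_zero {M X Y : Matrix (Fin n) (Fin n) ℤ} (hM : M.det ≠ 0)
    (h : M * X = M * Y) : X = Y := by
  have h' := congrArg (M.adjugate * ·) h
  simp only [← Matrix.mul_assoc, adjugate_mul, smul_mul, Matrix.one_mul] at h'
  exact smul_right_injective _ hM h'

theorem mul_right_cancel_of_det_ne_zero {M X Y : Matrix (Fin n) (Fin n) ℤ} (hM : M.det ≠ 0)
    (h : X * M = Y * M) : X = Y := by
  have h' := congrArg (· * M.adjugate) h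
  simp only [Matrix.mul_assoc, mul_adjugate, Matrix.mul_smul, Matrix.mul_one] at h'
  exact smul_right_injective _ hM h'

theorem mulVec_walkMap_of_mul_krylov (hχ : A.charpoly = B.charpoly) {l : ℤ}
    (hU : U * krylov A = l • krylov B) (f : ℤ[X]) : U *ᵥ walkMap A f = l • walkMap B f := by
  rw [walkMap_eq_krylov_mulVec, mulVec_mulVec, hU, smul_mulVec, hχ, ← walkMap_eq_krylov_mulVec]

/-- Both sides agree on the walk vectors of A, and the columns of `krylov A` span rationally. -/
theorem mul_aeval_of_mul_krylov (hdet : (krylov A).det ≠ 0) (hχ : A.charpoly = B.charpoly)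
    {l : ℤ} (hU : U * krylov A = l • krylov B) (f : ℤ[X]) :
    U * aeval A f = aeval B f * U := by
  apply mul_right_cancel_of_det_ne_zero hdet
  have col : ∀ (M : Matrix (Fin n) (Fin n) ℤ) (i j : Fin n),
      (M * krylov A) i j = (M *ᵥ walkMap A (X ^ (j : ℕ))) i := by
    intro M i j
    rw [walkMap_X_pow]
    rfl
  ext i j
  rw [col, col, ← mulVec_mulVec, ← mulVec_mulVec, ← walkMap_mul,
    mulVec_walkMap_of_mul_krylov hχ hU, mulVec_walkMap_of_mul_krylov hχ hU, walkMap_mul,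
    mulVec_smul]

theorem transpose_mul_self_of_mul_krylov (hdet : (krylov A).det ≠ 0)
    (hgram : (krylov A)ᵀ * krylov A = (krylov B)ᵀ * krylov B)
    {l : ℤ} (hU : U * krylov A = l • krylov B) : Uᵀ * U = (l ^ 2) • 1 := by
  have hdet' : (krylov A)ᵀ.det ≠ 0 := by rwa [det_transpose]
  apply mul_left_cancel_of_det_ne_zero hdet'
  apply mul_right_cancel_of_det_ne_zero hdet
  have e : (krylov A)ᵀ * (Uᵀ * U) * krylov A = (U * krylov A)ᵀ * (U * krylov A) := by
    rw [transpose_mul]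
    simp only [Matrix.mul_assoc]
  rw [e, hU, transpose_smul, smul_mul, Matrix.mul_smul, ← hgram, Matrix.mul_smul, Matrix.mul_one, smul_mul,
    smul_smul, pow_two]

theorem mul_transpose_self_of_transpose_mul_self {l : ℤ} (hl : l ≠ 0)
    (hU : Uᵀ * U = (l ^ 2) • 1) : U * Uᵀ = (l ^ 2) • 1 := by
  have hdet : U.det ≠ 0 := by
    intro h0
    have h := congrArg det hU
    rw [det_mul, h0, mul_zero, det_smul, det_one, mul_one] at h
    exact (pow_ne_zero _ (pow_ne_zero _ hl)) h.symm
  apply mul_right_cancel_of_det_ne_zero hdet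
  rw [Matrix.mul_assoc, hU, Matrix.mul_smul, smul_mul, Matrix.mul_one, Matrix.one_mul]

/-- If a minimal denominator `l` of the transition matrix between two walk matrices has a prime
factor `p`, then the walk matrix of `A` has an isotropic left kernel vector modulo `p`. -/
theorem exists_isotropic_of_dvd (hdet : (krylov A).det ≠ 0) (hχ : A.charpoly = B.charpoly)
    (hgram : (krylov A)ᵀ * krylov A = (krylov B)ᵀ * krylov B) {l : ℤ} (hl : l ≠ 0)
    (hU : U * krylov A = l • krylov B) {p : ℕ} [Fact p.Prime] (hp : (p : ℤ) ∣ l)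
    (hUp : ∃ i j, ¬ (p : ℤ) ∣ U i j) :
    ∃ u : Fin n → ℤ, Int.castRingHom (ZMod p) ∘ u ≠ 0 ∧ (∀ f, (p : ℤ) ∣ u ⬝ᵥ walkMap A f) ∧
      ∀ f : ℤ[X], (p : ℤ) ^ 2 ∣ u ⬝ᵥ (aeval A f *ᵥ u) := by
  obtain ⟨i, j, hij⟩ := hUp
  refine ⟨U i, fun h => hij ((intCast_comp_eq_zero_iff _).1 h j), fun f => ?_, fun f => ?_⟩
  · have h := congrFun (mulVec_walkMap_of_mul_krylov hχ hU f) i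
    rw [Pi.smul_apply, smul_eq_mul] at h
    change (p : ℤ) ∣ (U *ᵥ walkMap A f) i
    rw [h]
    exact hp.mul_right _
  · have h : U * aeval A f * Uᵀ = (l ^ 2) • aeval B f := by
      rw [mul_aeval_of_mul_krylov hdet hχ hU, Matrix.mul_assoc,
        mul_transpose_self_of_transpose_mul_self hl
          (transpose_mul_self_of_mul_krylov hdet hgram hU), Matrix.mul_smul, Matrix.mul_one]
    have e : U i ⬝ᵥ (aeval A f *ᵥ U i) = (U * aeval A f * Uᵀ) i i := by
      rw [Matrix.mul_assoc]
      rfl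
    rw [e, h, smul_apply, smul_eq_mul]
    exact (pow_dvd_pow_of_dvd hp 2).mul_right _

theorem exists_minimal_mul_krylov (B : Matrix (Fin n) (Fin n) ℤ) (hdet : (krylov A).det ≠ 0) :
    ∃ (l : ℕ) (U : Matrix (Fin n) (Fin n) ℤ), 0 < l ∧ U * krylov A = (l : ℤ) • krylov B ∧
      ∀ p : ℕ, p.Prime → p ∣ l → ∃ i j, ¬ (p : ℤ) ∣ U i j := by
  classical
  have hex : ∃ l : ℕ, 0 < l ∧ ∃ U : Matrix (Fin n) (Fin n) ℤ,
      U * krylov A = (l : ℤ) • krylov B := by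
    -- Cramer's rule clears denominators with the determinant; squaring it removes the sign.
    refine ⟨(krylov A).det.natAbs ^ 2, pow_pos (Int.natAbs_pos.2 hdet) 2,
      (krylov A).det • (krylov B * (krylov A).adjugate), ?_⟩
    rw [smul_mul, Matrix.mul_assoc, adjugate_mul, Matrix.mul_smul, Matrix.mul_one, smul_smul]
    push_cast
    rw [sq_abs, pow_two]
  obtain ⟨hl, U, hU⟩ := Nat.find_spec hex
  refine ⟨Nat.find hex, U, hl, hU, fun p hp hpl => ?_⟩
  by_contra! hall
  obtain ⟨c, hc⟩ := hpl
  choose V hV using hall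
  have hp0 : (p : ℤ) ≠ 0 := by exact_mod_cast hp.ne_zero
  have hc0 : 0 < c := Nat.pos_of_ne_zero fun h => by rw [hc, h, mul_zero] at hl; exact hl.false
  refine Nat.find_min hex (m := c) ?_ ⟨hc0, of V, ?_⟩
  · rw [hc]
    exact lt_mul_of_one_lt_left hc0 hp.one_lt
  · have hUV : U = (p : ℤ) • of V := by
      ext i j
      exact hV i j
    apply smul_right_injective _ hp0
    change (p : ℤ) • (of V * krylov A) = (p : ℤ) • ((c : ℤ) • krylov B)
    rw [← smul_mul, ← hUV, hU, hc, smul_smul, Nat.cast_mul]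

/-- Under the arithmetic condition on the determinant of the walk matrix of `A`, every symmetric
matrix with the same walk data is conjugate to `A` by an integral orthogonal matrix fixing `e`. -/
theorem exists_integral_orthogonal (hA : A.IsSymm) (hd : ∀ i, A i i = 0)
    (hχ : A.charpoly = B.charpoly)
    (hgram : (krylov A)ᵀ * krylov A = (krylov B)ᵀ * krylov B) {k : ℤ}
    (hk : (krylov A).det = k * 2 ^ (n / 2)) (hodd : Odd k) (hsq : Squarefree k) :
    ∃ U : Matrix (Fin n) (Fin n) ℤ, U * Uᵀ = 1 ∧ U * A = B * U ∧
      U *ᵥ (fun _ => 1) = fun _ => 1 := by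
  have hdet : (krylov A).det ≠ 0 := by
    rw [hk]
    exact mul_ne_zero hsq.ne_zero (pow_ne_zero _ two_ne_zero)
  obtain ⟨l, U, hl, hU, hmin⟩ := exists_minimal_mul_krylov B hdet
  have hl0 : (l : ℤ) ≠ 0 := by exact_mod_cast hl.ne'
  have hl1 : l = 1 := by
    by_contra hne
    obtain ⟨p, hp, hpl⟩ := Nat.exists_prime_and_dvd hne
    have : Fact p.Prime := ⟨hp⟩
    obtain ⟨u, hu, h₁, h₂⟩ := exists_isotropic_of_dvd hdet hχ hgram hl0 hU
      (Int.natCast_dvd_natCast.2 hpl) (hmin p hp hpl)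
    rcases hp.eq_two_or_odd' with rfl | hpodd
    · have h := two_pow_dvd_det_krylov hA hd u hu h₁ h₂
      rw [hk, pow_succ, mul_comm] at h
      have h2 : (2 : ℤ) ∣ k := Int.dvd_of_mul_dvd_mul_right (pow_ne_zero _ two_ne_zero) h
      exact (Int.not_even_iff_odd.2 hodd) (even_iff_two_dvd.2 h2)
    · have h := sq_dvd_det_krylov hA u hu h₁ h₂
      rw [hk] at h
      have hcop : IsCoprime ((p : ℤ) ^ 2) (2 ^ (n / 2)) := by
        apply IsCoprime.pow
        exact_mod_cast Nat.isCoprime_iff_coprime.2 hpodd.coprime_two_right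
      have h2 := hcop.dvd_of_dvd_mul_right h
      rw [pow_two] at h2
      have h3 := Int.isUnit_iff_natAbs_eq.1 (hsq _ h2)
      rw [Int.natAbs_natCast] at h3
      exact hp.one_lt.ne' h3
  subst hl1
  have h1 := mul_transpose_self_of_transpose_mul_self hl0
    (transpose_mul_self_of_mul_krylov hdet hgram hU)
  refine ⟨U, by simpa using h1, ?_, ?_⟩
  · simpa using mul_aeval_of_mul_krylov hdet hχ hU X
  · simpa [walkMap_one] using mulVec_walkMap_of_mul_krylov hχ hU 1

/-- The integers x_i² - x_i are nonnegative and sum to 0, so every entry is 0 or 1. -/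
theorem exists_eq_single_of_sum {x : Fin n → ℤ} (h₁ : x ⬝ᵥ x = 1) (h₂ : ∑ i, x i = 1) :
    ∃ j, x = Pi.single j 1 := by
  have hnn : ∀ i, 0 ≤ x i * x i - x i := by
    intro i
    rcases le_or_gt (x i) 0 with h | h
    · nlinarith
    · nlinarith
  have hsum : ∑ i, (x i * x i - x i) = 0 := by
    rw [Finset.sum_sub_distrib, h₂]
    exact sub_eq_zero.2 h₁
  have h01 : ∀ i, x i = 0 ∨ x i = 1 := by
    intro i
    have h := (Finset.sum_eq_zero_iff_of_nonneg fun i _ => hnn i).1 hsum i (Finset.mem_univ i)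
    have h' : x i * (x i - 1) = 0 := by linear_combination h
    rcases mul_eq_zero.1 h' with h | h
    · exact Or.inl h
    · exact Or.inr (by omega)
  obtain ⟨j, hj⟩ : ∃ j, x j ≠ 0 := by
    by_contra! hall
    simp [hall] at h₂
  have hj1 : x j = 1 := (h01 j).resolve_left hj
  refine ⟨j, funext fun i => ?_⟩
  by_cases hij : i = j
  · subst hij
    rw [hj1, Pi.single_eq_same]
  · rw [Pi.single_eq_of_ne hij]
    rw [← Finset.add_sum_erase _ _ (Finset.mem_univ j), hj1, add_eq_left] at h₂
    have hnn' : ∀ k ∈ Finset.univ.erase j, 0 ≤ x k := fun k _ => by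
      rcases h01 k with h | h <;> simp [h]
    exact (Finset.sum_eq_zero_iff_of_nonneg hnn').1 h₂ i
      (Finset.mem_erase.2 ⟨hij, Finset.mem_univ i⟩)

/-- An integral orthogonal matrix fixing the all-one vector is a permutation matrix. -/
theorem exists_perm_of_integral_orthogonal (hU : U * Uᵀ = 1)
    (he : U *ᵥ (fun _ => 1) = fun _ => 1) (hAB : U * A = B * U) :
    ∃ σ : Equiv.Perm (Fin n), ∀ i j, A (σ i) (σ j) = B i j := by
  have hrow : ∀ i, ∃ j, U i = Pi.single j 1 := by
    intro i
    apply exists_eq_single_of_sum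
    · have := congrFun (congrFun hU i) i
      rwa [one_apply_eq] at this
    · have := congrFun he i
      simpa [mulVec, dotProduct] using this
  choose σ hσ using hrow
  have hinj : Function.Injective σ := by
    intro i j hij
    by_contra hne
    have h : U i ⬝ᵥ U j = 0 := by
      have := congrFun (congrFun hU i) j
      rwa [one_apply_ne hne] at this
    rw [hσ i, hσ j, hij] at h
    simp at h
  refine ⟨Equiv.ofBijective σ (Finite.injective_iff_bijective.1 hinj), fun i j => ?_⟩
  have h := congrFun (congrFun hAB i) (σ j)
  have hl : (U * A) i (σ j) = A (σ i) (σ j) := by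
    rw [mul_apply, hσ i]
    simp [Pi.single_apply]
  have hr : (B * U) i (σ j) = B i j := by
    rw [mul_apply]
    simp [hσ, Pi.single_apply, hinj.eq_iff]
  rw [hl, hr] at h
  exact h

end Transition

end Matrix

/-! ### From spectra of graphs to integer matrices. -/

namespace SimpleGraph

theorem map_adjMatrix {V R : Type*} [CommRing R] (G : SimpleGraph V) [DecidableRel G.Adj] :
    (G.adjMatrix ℤ).map (Int.castRingHom R) = G.adjMatrix R := by
  ext i j
  simp [adjMatrix_apply]

/-- Real symmetric matrices have split characteristic polynomials, so no information is lost in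
passing to the real roots. -/
theorem charpoly_adjMatrix_eq_of_adjSpectrum_eq {V W : Type*} [Fintype V] [DecidableEq V]
    [Fintype W] [DecidableEq W] {G : SimpleGraph V} [DecidableRel G.Adj] {H : SimpleGraph W}
    [DecidableRel H.Adj] (h : G.adjSpectrum = H.adjSpectrum) :
    (G.adjMatrix ℤ).charpoly = (H.adjMatrix ℤ).charpoly := by
  apply Polynomial.map_injective (Int.castRingHom ℝ) Int.cast_injective
  rw [← Matrix.charpoly_map, ← Matrix.charpoly_map, map_adjMatrix, map_adjMatrix,
    (G.isHermitian_adjMatrix (R := ℝ)).splits_charpoly.eq_prod_roots_of_monic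
      (Matrix.charpoly_monic _),
    (H.isHermitian_adjMatrix (R := ℝ)).splits_charpoly.eq_prod_roots_of_monic
      (Matrix.charpoly_monic _)]
  exact congrArg (fun s => (s.map fun a => X - C a).prod) h

theorem adjMatrix_compl_eq {V : Type*} [Fintype V] [DecidableEq V] (G : SimpleGraph V)
    [DecidableRel G.Adj] : Gᶜ.adjMatrix ℤ = Matrix.of 1 - 1 - G.adjMatrix ℤ := by
  ext i j
  by_cases hij : i = j
  · subst hij; simp
  · by_cases h : G.Adj i j <;> simp [h, hij, adjMatrix_apply, compl_adj]

end SimpleGraph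

theorem theorem1p1 (n : ℕ) (G : SimpleGraph (Fin n)) [DecidableRel G.Adj]
    (hcontrollable : G.walkMatrix.det ≠ 0)
    (hF : ∃ k : ℤ, (G.walkMatrix.det : ℚ) / 2 ^ (n / 2) = k ∧ Odd k ∧ Squarefree k) :
    SimpleGraph.IsDGS.{0, v} G := by
  intro W _ _ H _ hGH
  obtain ⟨k, hk, hodd, hsq⟩ := hF
  have hdet : (Matrix.krylov (G.adjMatrix ℤ)).det = k * 2 ^ (n / 2) := by
    rw [div_eq_iff (by positivity)] at hk
    exact_mod_cast hk
  have hχ := SimpleGraph.charpoly_adjMatrix_eq_of_adjSpectrum_eq hGH.1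
  have hχc := SimpleGraph.charpoly_adjMatrix_eq_of_adjSpectrum_eq hGH.2
  -- The order of H is the degree of its characteristic polynomial, so H can be relabelled by `Fin
  -- n`.
  have hcard : Fintype.card W = n := by
    have := congrArg Polynomial.natDegree hχ
    simpa using this.symm
  let e : Fin n ≃ W := (Fintype.equivFinOfCardEq hcard).symm
  let B : Matrix (Fin n) (Fin n) ℤ := (H.adjMatrix ℤ).reindex e.symm e.symm
  have hB : B.IsSymm := (H.isSymm_adjMatrix (α := ℤ)).submatrix _
  have hA : (G.adjMatrix ℤ).IsSymm := G.isSymm_adjMatrix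
  have hχB : (G.adjMatrix ℤ).charpoly = B.charpoly := by rw [hχ, Matrix.charpoly_reindex]
  have hχcB : (Matrix.of 1 - 1 - G.adjMatrix ℤ).charpoly = (Matrix.of 1 - 1 - B).charpoly := by
    have : Matrix.of 1 - 1 - B = (Hᶜ.adjMatrix ℤ).reindex e.symm e.symm := by
      rw [SimpleGraph.adjMatrix_compl_eq]
      ext i j
      simp [B, Matrix.one_apply]
    rw [this, Matrix.charpoly_reindex, ← hχc, SimpleGraph.adjMatrix_compl_eq]
  obtain ⟨U, hU, hAB, he⟩ := Matrix.exists_integral_orthogonal hA (fun i => by simp) hχB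
    (Matrix.krylov_transpose_mul_krylov hA hB (Matrix.sum_walk_eq_of_charpoly_eq hχB hχcB))
    hdet hodd hsq
  obtain ⟨σ, hσ⟩ := Matrix.exists_perm_of_integral_orthogonal hU he hAB
  refine ⟨⟨e.symm.trans σ, ?_⟩⟩
  intro a b
  have h := hσ (e.symm a) (e.symm b)
  simp only [B, Matrix.reindex_apply, Matrix.submatrix_apply, Equiv.symm_symm,
    Equiv.apply_symm_apply, SimpleGraph.adjMatrix_apply] at h
  by_cases h1 : G.Adj (σ (e.symm a)) (σ (e.symm b)) <;> by_cases h2 : H.Adj a b <;>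
    simp_all
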